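/- Let $\overline{\mathbb{Q}}\subset\mathbb{C}$ be the field of algebraic numbers and let $\Gamma$ be the absolute Galois group, that is, the group of all field automorphisms of $\overline{\mathbb{Q}}$. For $\sigma\in\Gamma$ and $p(z)=\sum_i a_i z^i\in\overline{\mathbb{Q}}[z]$ write $p^\sigma(z)=\sum_i \sigma(a_i) z^i$. A \emph{biased Shabat polynomial} is a polynomial $f\in\mathbb{C}[z]$ such that (i) for every $u\in\mathbb{C}$, if $f'(u)=0$ then $f(u)\in\{-1,+1\}$; (ii) $f(0)=0$; and (iii) $f'(0)=1$. For $n\ge 0$ let $\mathcal{S}_n$ be the set of all biased Shabat polynomials of degree $n$. Then, for every $n$, the group $\Gamma$ acts on $\mathcal{S}_n$ by acting on the coefficients. That is: every $f\in\mathcal{S}_n$ has coefficients in $\overline{\mathbb{Q}}$, and there is a (necessarily unique) group action of $\Gamma$ on $\mathcal{S}_n$ for which $\sigma\in\Gamma$ sends $f\in\mathcal{S}_n$ to $f^\sigma$. Moreover, the defining conditions are Galois invariant: for every $p\in\overline{\mathbb{Q}}[z]$ and $\sigma\in\Gamma$, each of the conditions (i), (ii), (iii) holds for $p^\sigma$ if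 and only if it holds for $p$, and $p^\sigma$ has the same degree as $p$. -/

import Mathlib

open Polynomial

/-- The field of algebraic numbers, as a subfield of `ℂ`. -/
noncomputable abbrev Qbar : IntermediateField ℚ ℂ := algebraicClosure ℚ ℂ

/-- The absolute Galois group: all field automorphisms of the field of algebraic numbers,
with composition as multiplication. -/
abbrev AbsGal : Type := RingAut Qbar

/-- A polynomial with algebraic coefficients, seen as a polynomial with complex coefficients. -/
noncomputable def toComplexPoly (p : Qbar[X]) : ℂ[X] := p.map (algebraMap Qbar ℂ)

/-- The result of applying a field automorphism to every coefficient of a polynomial. -/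
noncomputable def galoisConj (σ : AbsGal) (p : Qbar[X]) : Qbar[X] :=
  p.map (σ : Qbar →+* Qbar)

/-- Every complex critical point of `f` is mapped by `f` to `-1` or to `+1`. -/
def CriticalValuesPlusMinusOne (f : ℂ[X]) : Prop :=
  ∀ u : ℂ, f.derivative.eval u = 0 → f.eval u = -1 ∨ f.eval u = 1

/-- Biased Shabat polynomials: complex polynomials `f` all of whose critical values lie in
`{-1, +1}`, with `f(0) = 0` and `f'(0) = 1`. -/
structure IsBiasedShabat (f : ℂ[X]) : Prop where
  criticalValues : CriticalValuesPlusMinusOne f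
  eval_zero : f.eval 0 = 0
  derivative_eval_zero : f.derivative.eval 0 = 1

/-- The set of all biased Shabat polynomials of degree `n`. -/
def biasedShabat (n : ℕ) : Set ℂ[X] := {f | IsBiasedShabat f ∧ f.degree = n}

open scoped Polynomial

/-! Algebraicity is a rigidity argument. Let a derivation `D` of `ℂ` over `ℚ` act on the
coefficients of `f`, giving `f^D`. Since `D` kills the critical values, `f'` divides `f^D`; the
quotient has degree at most 1, and the normalisation at 0 makes it vanish to order 2, so `f^D = 0`.
A number killed by every such `D` is algebraic. Galois invariance is then formal once the critical
value condition is tested only at algebraic points, where automorphisms act. -/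

section Derivations

/-- An element of a characteristic zero field extension `E / F` which is annihilated by every
`F`-derivation of `E` is algebraic over `F`. -/
theorem isAlgebraic_of_forall_derivation_eq_zero {F E : Type*} [Field F] [Field E] [CharZero F]
    [Algebra F E] {c : E} (hc : ∀ D : Derivation F E E, D c = 0) : IsAlgebraic F c := by
  have hcΩ : KaehlerDifferential.D F E c = 0 :=
    (Module.forall_dual_apply_eq_zero_iff E _).1 fun φ ↦ hc (φ.compDer (KaehlerDifferential.D F E))
  let K := IntermediateField.adjoin F {c}
  have hK : ∀ y : E, y ∈ K → KaehlerDifferential.D F E y = 0 := fun y hy ↦ by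
    induction hy using IntermediateField.adjoin_induction with
    | mem x hx => rwa [Set.mem_singleton_iff.1 hx]
    | algebraMap x => simp
    | add x y _ _ hx hy => simp [hx, hy]
    | inv x _ hx => simp [Derivation.leibniz_inv, hx]
    | mul x y _ _ hx hy => simp [hx, hy]
  have : CharZero K := charZero_of_injective_algebraMap (algebraMap F K).injective
  obtain ⟨s, hs⟩ := exists_isTranscendenceBasis K E
  have := hs.isAlgebraic_field
  have : Algebra.FormallySmooth K E := .of_algebraicIndependent_of_isSeparable hs.1
  -- Formal smoothness of `E / K` kills `H1Cotangent`, so no differential of `K = F(c)` dies in `E`;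
  -- hence `dc = 0` forces `Ω[K⁄F] = 0`.
  have hinj : Function.Injective (KaehlerDifferential.mapBaseChange F K E) := by
    rw [injective_iff_map_eq_zero]
    intro x hx
    obtain ⟨y, rfl⟩ := (Algebra.H1Cotangent.exact_δ_mapBaseChange F K E x).1 hx
    rw [Subsingleton.elim y 0, map_zero]
  have : Module.Free K E := .of_divisionRing K E
  have : Module.FaithfullyFlat K E := inferInstance
  have hDK (y : K) : KaehlerDifferential.D F K y = 0 := by
    have h : (1 : E) ⊗ₜ[K] KaehlerDifferential.D F K y = 0 := hinj <| by
      simpa using hK y y.2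
    exact (Module.FaithfullyFlat.one_tmul_eq_zero_iff K _ _).1 h
  have : Subsingleton (Ω[K⁄F]) := by
    rw [← Submodule.subsingleton_iff K, ← subsingleton_iff_bot_eq_top,
      ← KaehlerDifferential.span_range_derivation, eq_comm, Submodule.span_eq_bot]
    rintro _ ⟨y, rfl⟩
    exact hDK y
  have : Algebra.FormallyUnramified F K := ⟨this⟩
  have : Algebra.EssFiniteType F K :=
    IntermediateField.essFiniteType_iff.2 ⟨{c}, by simp [K]⟩
  have : Algebra.IsSeparable F K := Algebra.FormallyUnramified.isSeparable F K
  have := Algebra.IsAlgebraic.isAlgebraic (R := F)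
    (⟨c, IntermediateField.mem_adjoin_simple_self F c⟩ : K)
  exact this.algebraMap (A := E)

end Derivations

section Rigidity

variable {k : Type*} [Field k] [IsAlgClosed k] [CharZero k] [Differential k]

open Differential in
/-- If all critical values of `f` are constants of a derivation, then `f'` divides the polynomial
obtained by differentiating the coefficients of `f`. -/
theorem Polynomial.derivative_dvd_mapCoeffs {f : k[X]} (hf : f.derivative ≠ 0)
    (hcrit : ∀ u, f.derivative.eval u = 0 → (f.eval u)′ = 0) :
    f.derivative ∣ mapCoeffs f := by
  classical
  by_cases hg : mapCoeffs f = 0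
  · simp [hg]
  rw [IsAlgClosed.dvd_iff_roots_le_roots hf hg, Multiset.le_iff_count]
  intro u
  rw [count_roots, count_roots]
  by_cases hu : f.derivative.IsRoot u
  · set h := f - C (f.eval u) with hh
    have hroot : h.IsRoot u := by simp [h]
    have hm : f.derivative.rootMultiplicity u = h.rootMultiplicity u - 1 := by
      rw [← derivative_rootMultiplicity_of_root hroot]; simp [h]
    -- The subtracted value is a constant of the derivation. By Leibniz, a derivation lowers the
    -- order of `(X - u)^m * q` at `u` by at most one, even if `u` itself is not constant.
    have hD : mapCoeffs f = mapCoeffs h := by simp [h, hcrit u hu]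
    rw [le_rootMultiplicity_iff hg, hm, hD]
    obtain ⟨q, hq⟩ := pow_rootMultiplicity_dvd h u
    generalize h.rootMultiplicity u = m at hq ⊢
    rw [hq, Derivation.leibniz, Derivation.leibniz_pow, smul_eq_mul, smul_eq_mul, smul_eq_mul,
      nsmul_eq_mul]
    exact dvd_add ((pow_dvd_pow _ (Nat.sub_le m 1)).mul_right _)
      (((dvd_mul_right _ _).mul_left _).mul_left _)
  · rw [rootMultiplicity_eq_zero hu]
    exact Nat.zero_le _

open Differential in
/-- A normalised polynomial with constant critical values has constant coefficients. -/
theorem Polynomial.mapCoeffs_eq_zero_of_criticalValues {f : k[X]}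
    (hcrit : ∀ u, f.derivative.eval u = 0 → (f.eval u)′ = 0)
    (h0 : f.eval 0 = 0) (h1 : f.derivative.eval 0 = 1) : mapCoeffs f = 0 := by
  have hf' : f.derivative ≠ 0 := by rintro h; simp [h] at h1
  obtain ⟨q, hq⟩ := derivative_dvd_mapCoeffs hf' hcrit
  have hc0 : f.coeff 0 = 0 := by rwa [coeff_zero_eq_eval_zero]
  have hd0 : f.derivative.coeff 0 = 1 := by rwa [coeff_zero_eq_eval_zero]
  have hc1 : f.coeff 1 = 1 := by simpa [coeff_derivative] using hd0
  have hq0 : q.coeff 0 = 0 := by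
    have := congrArg (coeff · 0) hq
    simpa [mul_coeff_zero, hd0, hc0] using this.symm
  have hq1 : q.coeff 1 = 0 := by
    have := congrArg (coeff · 1) hq
    simpa [mul_coeff_one, hd0, hc1, hq0] using this.symm
  -- `mapCoeffs` does not raise the degree, while `f'` has degree one less than `f`.
  have hdeg : q.natDegree ≤ 1 := by
    by_cases hq' : q = 0
    · simp [hq']
    have h2 : (mapCoeffs f).natDegree ≤ f.natDegree :=
      natDegree_le_iff_coeff_eq_zero.2 fun N hN ↦ by simp [coeff_eq_zero_of_natDegree_lt hN]
    rw [hq, natDegree_mul hf' hq', natDegree_derivative] at h2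
    omega
  have : q = 0 := by
    rw [eq_X_add_C_of_natDegree_le_one hdeg, hq0, hq1]
    simp
  rw [hq, this, mul_zero]

end Rigidity

open Polynomial

theorem IsBiasedShabat.isAlgebraic_coeff {f : ℂ[X]} (hf : IsBiasedShabat f) (i : ℕ) :
    IsAlgebraic ℚ (f.coeff i) := by
  refine isAlgebraic_of_forall_derivation_eq_zero fun D ↦ ?_
  let : Differential ℂ := ⟨D.restrictScalars ℤ⟩
  have hcrit : ∀ u, f.derivative.eval u = 0 → Differential.deriv (f.eval u) = 0 := fun u hu ↦ by
    rcases hf.criticalValues u hu with h | h <;> simp [h]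
  have := mapCoeffs_eq_zero_of_criticalValues hcrit hf.eval_zero hf.derivative_eval_zero
  exact congrArg (coeff · i) this

theorem toComplexPoly_injective : Function.Injective toComplexPoly :=
  map_injective _ (algebraMap Qbar ℂ).injective

theorem IsBiasedShabat.exists_toComplexPoly_eq {f : ℂ[X]} (hf : IsBiasedShabat f) :
    ∃ p : Qbar[X], toComplexPoly p = f := by
  refine (mem_lifts f).1 ((lifts_iff_coeff_lifts f).2 fun i ↦ ?_)
  exact ⟨⟨f.coeff i, mem_algebraicClosure_iff.2 (hf.isAlgebraic_coeff i)⟩, rfl⟩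

theorem eval_toComplexPoly (p : Qbar[X]) (u : Qbar) :
    (toComplexPoly p).eval (u : ℂ) = (p.eval u : Qbar) :=
  eval_map_apply (algebraMap Qbar ℂ) u

theorem eval_galoisConj (σ : AbsGal) (p : Qbar[X]) (u : Qbar) :
    (galoisConj σ p).eval (σ u) = σ (p.eval u) :=
  eval_map_apply (σ : Qbar →+* Qbar) u

theorem derivative_toComplexPoly (p : Qbar[X]) :
    (toComplexPoly p).derivative = toComplexPoly p.derivative :=
  derivative_map p _

theorem derivative_galoisConj (σ : AbsGal) (p : Qbar[X]) :
    (galoisConj σ p).derivative = galoisConj σ p.derivative :=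
  derivative_map p _

theorem galoisConj_one (p : Qbar[X]) : galoisConj 1 p = p := by
  ext i; simp [galoisConj]

theorem galoisConj_mul (σ τ : AbsGal) (p : Qbar[X]) :
    galoisConj (σ * τ) p = galoisConj σ (galoisConj τ p) := by
  ext i; simp [galoisConj]

/-- The critical values of a polynomial with algebraic coefficients may be tested at algebraic
numbers. -/
theorem criticalValuesPlusMinusOne_toComplexPoly_iff (p : Qbar[X]) :
    CriticalValuesPlusMinusOne (toComplexPoly p) ↔
      ∀ u : Qbar, p.derivative.eval u = 0 → p.eval u = -1 ∨ p.eval u = 1 := by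
  have key (u : Qbar) : ((toComplexPoly p).derivative.eval (u : ℂ) = 0 →
      (toComplexPoly p).eval (u : ℂ) = -1 ∨ (toComplexPoly p).eval (u : ℂ) = 1) ↔
      (p.derivative.eval u = 0 → p.eval u = -1 ∨ p.eval u = 1) := by
    rw [derivative_toComplexPoly, eval_toComplexPoly, eval_toComplexPoly]
    norm_cast
  refine ⟨fun h u ↦ (key u).1 (h u), fun h u hu ↦ ?_⟩
  by_cases hp : p.derivative = 0
  -- Here every complex `u` is critical, possibly transcendental, but the polynomial is constant, so
  -- its value at 0 decides.
  · have h0 := (key 0).2 (h 0)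
    rw [eq_C_of_derivative_eq_zero hp] at h0 ⊢
    simpa [toComplexPoly] using h0
  · have hu' : IsAlgebraic Qbar u := ⟨p.derivative, hp, by
      rwa [derivative_toComplexPoly, toComplexPoly, eval_map_algebraMap] at hu⟩
    have : u ∈ Qbar := by
      have : Algebra.IsAlgebraic ℚ Qbar := algebraicClosure.isAlgebraic ℚ ℂ
      exact mem_algebraicClosure_iff.2 (hu'.restrictScalars ℚ)
    exact (key ⟨u, this⟩).2 (h _) hu

theorem criticalValuesPlusMinusOne_galoisConj_iff (σ : AbsGal) (p : Qbar[X]) :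
    CriticalValuesPlusMinusOne (toComplexPoly (galoisConj σ p)) ↔
      CriticalValuesPlusMinusOne (toComplexPoly p) := by
  rw [criticalValuesPlusMinusOne_toComplexPoly_iff, criticalValuesPlusMinusOne_toComplexPoly_iff,
    σ.surjective.forall]
  refine forall_congr' fun u ↦ ?_
  rw [derivative_galoisConj, eval_galoisConj, eval_galoisConj, map_eq_zero_iff σ σ.injective,
    map_eq_one_iff σ σ.injective, show σ (p.eval u) = -1 ↔ p.eval u = -1 by
      rw [← σ.injective.eq_iff (a := p.eval u), map_neg, map_one]]

theorem eval_zero_toComplexPoly_galoisConj (σ : AbsGal) (p : Qbar[X]) :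
    (toComplexPoly (galoisConj σ p)).eval 0 = (σ (p.eval 0) : Qbar) := by
  rw [← eval_galoisConj, map_zero, ← eval_toComplexPoly]; rfl

theorem eval_zero_toComplexPoly (p : Qbar[X]) :
    (toComplexPoly p).eval 0 = (p.eval 0 : Qbar) := by
  rw [← eval_toComplexPoly]; rfl

theorem eval_zero_galoisConj_eq_zero_iff (σ : AbsGal) (p : Qbar[X]) :
    (toComplexPoly (galoisConj σ p)).eval 0 = 0 ↔ (toComplexPoly p).eval 0 = 0 := by
  rw [eval_zero_toComplexPoly_galoisConj, eval_zero_toComplexPoly]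
  norm_cast
  exact map_eq_zero_iff σ σ.injective

theorem derivative_eval_zero_galoisConj_eq_one_iff (σ : AbsGal) (p : Qbar[X]) :
    (toComplexPoly (galoisConj σ p)).derivative.eval 0 = 1 ↔
      (toComplexPoly p).derivative.eval 0 = 1 := by
  rw [derivative_toComplexPoly, derivative_galoisConj, eval_zero_toComplexPoly_galoisConj,
    derivative_toComplexPoly, eval_zero_toComplexPoly]
  norm_cast
  exact map_eq_one_iff σ σ.injective

theorem degree_toComplexPoly_galoisConj (σ : AbsGal) (p : Qbar[X]) :
    (toComplexPoly (galoisConj σ p)).degree = (toComplexPoly p).degree := by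
  rw [toComplexPoly, toComplexPoly, degree_map, degree_map, galoisConj]
  exact degree_map_eq_of_injective σ.injective p

theorem toComplexPoly_galoisConj_mem_biasedShabat {n : ℕ} (σ : AbsGal) {p : Qbar[X]}
    (hp : toComplexPoly p ∈ biasedShabat n) :
    toComplexPoly (galoisConj σ p) ∈ biasedShabat n :=
  ⟨⟨(criticalValuesPlusMinusOne_galoisConj_iff σ p).2 hp.1.criticalValues,
    (eval_zero_galoisConj_eq_zero_iff σ p).2 hp.1.eval_zero,
    (derivative_eval_zero_galoisConj_eq_one_iff σ p).2 hp.1.derivative_eval_zero⟩,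
    (degree_toComplexPoly_galoisConj σ p).trans hp.2⟩

/-- The polynomial with algebraic coefficients underlying a biased Shabat polynomial. -/
noncomputable def biasedShabat.algebraicPoly {n : ℕ} (f : biasedShabat n) : Qbar[X] :=
  f.2.1.exists_toComplexPoly_eq.choose

theorem biasedShabat.toComplexPoly_algebraicPoly {n : ℕ} (f : biasedShabat n) :
    toComplexPoly (algebraicPoly f) = f :=
  f.2.1.exists_toComplexPoly_eq.choose_spec

/-- Makes the chosen lift canonical, which gives compatibility of the action with products. -/
theorem biasedShabat.algebraicPoly_eq {n : ℕ} {f : biasedShabat n} {p : Qbar[X]}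
    (hp : toComplexPoly p = f) : algebraicPoly f = p :=
  toComplexPoly_injective ((toComplexPoly_algebraicPoly f).trans hp.symm)

/-- The action of the absolute Galois group on biased Shabat polynomials of degree `n`. -/
noncomputable abbrev biasedShabat.galoisAction (n : ℕ) : MulAction AbsGal (biasedShabat n) where
  smul σ f := ⟨toComplexPoly (galoisConj σ (algebraicPoly f)),
    toComplexPoly_galoisConj_mem_biasedShabat σ <| by
      rw [toComplexPoly_algebraicPoly]; exact f.2⟩
  one_smul f := Subtype.ext <| by
    change toComplexPoly (galoisConj 1 (algebraicPoly f)) = f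
    rw [galoisConj_one, toComplexPoly_algebraicPoly]
  mul_smul σ τ f := Subtype.ext <| by
    change toComplexPoly (galoisConj (σ * τ) (algebraicPoly f)) =
      toComplexPoly (galoisConj σ (algebraicPoly
        ⟨toComplexPoly (galoisConj τ (algebraicPoly f)), _⟩))
    rw [galoisConj_mul]
    exact congrArg (toComplexPoly <| galoisConj σ ·) (algebraicPoly_eq rfl).symm

theorem mainTheorem3 (n : ℕ) :
    -- the coefficients of a biased Shabat polynomial are algebraic numbers
    (∀ f ∈ biasedShabat n, ∃ p : Qbar[X], toComplexPoly p = f) ∧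
    -- the Galois group acts on biased Shabat polynomials of degree `n`, through the coefficients
    (∃! act : MulAction AbsGal (biasedShabat n),
      ∀ (σ : AbsGal) (f : biasedShabat n) (p : Qbar[X]), toComplexPoly p = (f : ℂ[X]) →
        ((act.smul σ f : biasedShabat n) : ℂ[X]) = toComplexPoly (galoisConj σ p)) ∧
    -- each of the defining conditions is Galois invariant
    (∀ (σ : AbsGal) (p : Qbar[X]),
      (CriticalValuesPlusMinusOne (toComplexPoly (galoisConj σ p)) ↔
        CriticalValuesPlusMinusOne (toComplexPoly p)) ∧
      ((toComplexPoly (galoisConj σ p)).eval 0 = 0 ↔ (toComplexPoly p).eval 0 = 0) ∧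
      ((toComplexPoly (galoisConj σ p)).derivative.eval 0 = 1 ↔
        (toComplexPoly p).derivative.eval 0 = 1) ∧
      (toComplexPoly (galoisConj σ p)).degree = (toComplexPoly p).degree) := by
  refine ⟨fun f hf ↦ hf.1.exists_toComplexPoly_eq,
    ⟨biasedShabat.galoisAction n, fun σ f p hp ↦ ?_, fun act hact ↦ ?_⟩,
    fun σ p ↦ ⟨criticalValuesPlusMinusOne_galoisConj_iff σ p,
      eval_zero_galoisConj_eq_zero_iff σ p, derivative_eval_zero_galoisConj_eq_one_iff σ p,
      degree_toComplexPoly_galoisConj σ p⟩⟩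
  · rw [← biasedShabat.algebraicPoly_eq hp]
    rfl
  · refine MulAction.ext <| funext fun σ ↦ funext fun f ↦ Subtype.ext ?_
    exact hact σ f _ (biasedShabat.toComplexPoly_algebraicPoly f)
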